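/- Let $X$ be a real Banach space, let $\varphi\in X^*\setminus\{0\}$, and let $\psi:X\to\mathbb{R}$ be Lipschitz with constant $\|\varphi\|_{X^*}$, i.e. $|\psi(x)-\psi(y)|\le\|\varphi\|_{X^*}\|x-y\|$ for all $x,y\in X$. Let $[a,b]$ (with $a\le b$) be a compact real interval, let $\gamma:[a,b]\to[-1,1]$ be a continuous function such that the set $\gamma^{-1}(\{-1,1\})$ has empty interior, and let $c\in\mathbb{R}$. Assume that either (i) $\gamma$ is convex and $\gamma(a)\psi(x)+ca\neq\gamma(b)\psi(x)+cb$ for all $x\in X$ with $\psi(x)>0$; or (ii) $\gamma$ is concave and $\gamma(a)\psi(x)+ca\neq\gamma(b)\psi(x)+cb$ for all $x\in X$ with $\psi(x)<0$. Then, as an equality in $[-\infty,+\infty]$ and with the convention $\sup\emptyset=-\infty$, $$\sup_{\lambda\in\gamma^{-1}(\{-1,1\})}\ \inf_{x\in X}\bigl(\varphi(x)+\gamma(\lambda)\psi(x)+c\lambda\bigr)=\inf_{x\in X}\ \sup_{\lambda\in[a,b]}\bigl(\varphi(x)+\gamma(\lambda)\psi(x)+c\lambda\bigr).$$ -/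

import Mathlib

open Set Topology

/-! If equality fails, a real `r` lies strictly between the two sides. With `f x l = φ x + γ l * ψ x
+ c * l`, each `f x` then has maximum above `r`, and each set `{x | f x l < r}` is nonempty: by
choice of `r` if `γ l = ±1`, otherwise because `φ` dominates `γ l * ψ`. In the latter case, which
holds for a dense set of `l`, the set is also connected. Convexity or concavity keeps `f x` at least
`r` between maximizers, so `f x l < r` puts `l` strictly to one side of all maximizers of `f x`.
Each side is an open condition, and both occur, at opposite ends of the interval. Connectedness of
the interval makes both occur over a common open set of `l`; for a dense one, they separate a
connected sublevel set. -/

/-- A minimax principle in contradiction form: over a connected compact linear order `I`, the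
sublevel sets `{x | f x l < r}` cannot be nonempty for every `l`, and preconnected for a dense set
of `l`, if no point between two (possibly equal) maximizers of any `f x` has value below `r`. -/
theorem false_of_preconnected_sublevel {X I : Type*} [TopologicalSpace X]
    [LinearOrder I] [BoundedOrder I] [TopologicalSpace I] [OrderClosedTopology I]
    [CompactSpace I] [PreconnectedSpace I]
    (f : X → I → ℝ) (hf : Continuous fun p : X × I => f p.1 p.2) (r : ℝ)
    (D : Set I) (hD : Dense D)
    (hconn : ∀ l ∈ D, IsPreconnected {x | f x l < r})
    (hlow : ∀ l, ∃ x, f x l < r)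
    (hmax : ∀ x m n l, (∀ k, f x k ≤ f x m) → (∀ k, f x k ≤ f x n) → m ≤ l → l ≤ n →
      r ≤ f x l) : False := by
  have hF : IsClosed {q : (X × I) × I | ∀ k, f q.1.1 k ≤ f q.1.1 q.2} := by
    simp only [ofPred_forall]
    refine isClosed_iInter fun k => isClosed_le ?_ ?_
    · exact hf.comp (by fun_prop : Continuous fun q : (X × I) × I => (q.1.1, k))
    · exact hf.comp (by fun_prop : Continuous fun q : (X × I) × I => (q.1.1, q.2))
  let U : Set (X × I) := {p | ∀ m, (∀ k, f p.1 k ≤ f p.1 m) → m < p.2}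
  let V : Set (X × I) := {p | ∀ m, (∀ k, f p.1 k ≤ f p.1 m) → p.2 < m}
  have hU : IsOpen U := by
    -- The complement of `U` is a projection along the compact factor `I` of a closed set.
    have h := isClosedMap_fst_of_compactSpace (X := X × I) (Y := I) _
      (hF.inter (isClosed_le (continuous_snd.comp continuous_fst) continuous_snd))
    convert h.isOpen_compl using 1
    ext p
    simp only [U, mem_ofPred_eq, mem_compl_iff, mem_image, mem_inter_iff, Prod.exists, not_exists]
    constructor
    · rintro hp x l m ⟨⟨h1, h2⟩, rfl⟩
      exact (hp m h1).not_ge h2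
    · intro hp m hm
      by_contra hlt
      exact hp p.1 p.2 m ⟨⟨hm, not_lt.1 hlt⟩, rfl⟩
  have hV : IsOpen V := by
    have h := isClosedMap_fst_of_compactSpace (X := X × I) (Y := I) _
      (hF.inter (isClosed_le continuous_snd (continuous_snd.comp continuous_fst)))
    convert h.isOpen_compl using 1
    ext p
    simp only [V, mem_ofPred_eq, mem_compl_iff, mem_image, mem_inter_iff, Prod.exists, not_exists]
    constructor
    · rintro hp x l m ⟨⟨h1, h2⟩, rfl⟩
      exact (hp m h1).not_ge h2
    · intro hp m hm
      by_contra hlt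
      exact hp p.1 p.2 m ⟨⟨hm, not_lt.1 hlt⟩, rfl⟩
  have hS : IsOpen {p : X × I | f p.1 p.2 < r} := isOpen_lt hf continuous_const
  have hex : ∀ x, ∃ m, ∀ k, f x k ≤ f x m := fun x => by
    have hc : Continuous (f x) := hf.comp (by fun_prop : Continuous fun l : I => (x, l))
    obtain ⟨m, -, hm⟩ := isCompact_univ.exists_isMaxOn (univ_nonempty (α := I)) hc.continuousOn
    exact ⟨m, fun k => hm (mem_univ k)⟩
  have hcov : ∀ x l, f x l < r → (x, l) ∈ U ∨ (x, l) ∈ V := by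
    intro x l hl
    by_contra! hcon
    simp only [U, V, mem_ofPred_eq, not_forall, not_lt] at hcon
    obtain ⟨⟨n, hn, hln⟩, m, hm, hml⟩ := hcon
    exact hl.not_ge (hmax x m n l hm hn hml hln)
  have hdis : ∀ p, p ∈ U → p ∉ V := fun p hu hv => by
    obtain ⟨m, hm⟩ := hex p.1
    exact lt_asymm (hu m hm) (hv m hm)
  have hA := isOpenMap_snd _ (hS.inter hU)
  have hB := isOpenMap_snd _ (hS.inter hV)
  obtain ⟨l, hl⟩ : ((Prod.snd '' ({p : X × I | f p.1 p.2 < r} ∩ U)) ∩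
      (Prod.snd '' ({p : X × I | f p.1 p.2 < r} ∩ V))).Nonempty := by
    refine nonempty_inter hA hB ?_ ?_ ?_
    · refine eq_univ_of_forall fun l => ?_
      obtain ⟨x, hx⟩ := hlow l
      rcases hcov x l hx with h | h
      · exact Or.inl ⟨(x, l), ⟨hx, h⟩, rfl⟩
      · exact Or.inr ⟨(x, l), ⟨hx, h⟩, rfl⟩
    · obtain ⟨x, hx⟩ := hlow ⊤
      refine ⟨⊤, (x, ⊤), ⟨hx, (hcov x ⊤ hx).resolve_right fun h => ?_⟩, rfl⟩
      obtain ⟨m, hm⟩ := hex x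
      exact not_top_lt (h m hm)
    · obtain ⟨x, hx⟩ := hlow ⊥
      refine ⟨⊥, (x, ⊥), ⟨hx, (hcov x ⊥ hx).resolve_left fun h => ?_⟩, rfl⟩
      obtain ⟨m, hm⟩ := hex x
      exact not_lt_bot (h m hm)
  obtain ⟨_, ⟨⟨⟨x, _⟩, ⟨hx, hxU⟩, rfl⟩, ⟨y, l⟩, ⟨hy, hyV⟩, rfl⟩, hlD⟩ :=
    hD.inter_open_nonempty _ (hA.inter hB) ⟨l, hl⟩
  have hcl : Continuous fun z : X => (z, l) := by fun_prop
  obtain ⟨z, -, hzU, hzV⟩ := hconn l hlD _ _ (hU.preimage hcl) (hV.preimage hcl)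
    (fun z hz => hcov z l hz) ⟨x, hx, hxU⟩ ⟨y, hy, hyV⟩
  exact hdis _ hzU hzV

section Perturbation

variable {X : Type*} [NormedAddCommGroup X] [NormedSpace ℝ X]

/-- A perturbation of a nonzero functional `φ` by `k * ψ` with `ψ` `‖φ‖`-Lipschitz and `|k| < 1`
decreases at a linear rate in some direction. -/
theorem exists_direction_linear_decrease (φ : X →L[ℝ] ℝ) (hφ : φ ≠ 0) (ψ : X → ℝ)
    (hψ : LipschitzWith ‖φ‖₊ ψ) (k : ℝ) (hk : |k| < 1) :
    ∃ (u : X) (δ : ℝ), 0 < δ ∧ ∀ (x : X) (t : ℝ), 0 ≤ t →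
      φ (x + t • u) + k * ψ (x + t • u) ≤ φ x + k * ψ x - δ * t := by
  have hpos : 0 < ‖φ‖ := norm_pos_iff.2 hφ
  obtain ⟨v, hv⟩ : ∃ v, |k| * ‖φ‖ * ‖v‖ < ‖φ v‖ := by
    by_contra! h
    have := φ.opNorm_le_bound (by positivity) h
    nlinarith
  obtain ⟨u, hu⟩ : ∃ u, |k| * ‖φ‖ * ‖u‖ < -φ u := by
    rcases le_total (φ v) 0 with h | h
    · exact ⟨v, by rwa [Real.norm_of_nonpos h] at hv⟩
    · exact ⟨-v, by simpa [Real.norm_of_nonneg h] using hv⟩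
  refine ⟨u, -φ u - |k| * ‖φ‖ * ‖u‖, by linarith, fun x t ht => ?_⟩
  have h1 : |ψ (x + t • u) - ψ x| ≤ ‖φ‖ * (t * ‖u‖) := by
    have := hψ.dist_le_mul (x + t • u) x
    simpa [Real.dist_eq, norm_smul, abs_of_nonneg ht] using this
  have h2 : k * (ψ (x + t • u) - ψ x) ≤ |k| * (‖φ‖ * (t * ‖u‖)) :=
    (le_abs_self _).trans (by rw [abs_mul]; gcongr)
  simp only [map_add, map_smul, smul_eq_mul]
  linarith

theorem exists_perturbation_lt (φ : X →L[ℝ] ℝ) (hφ : φ ≠ 0) (ψ : X → ℝ)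
    (hψ : LipschitzWith ‖φ‖₊ ψ) (k : ℝ) (hk : |k| < 1) (r : ℝ) :
    ∃ x, φ x + k * ψ x < r := by
  obtain ⟨u, δ, hδ, h⟩ := exists_direction_linear_decrease φ hφ ψ hψ k hk
  obtain ⟨n, hn⟩ := exists_nat_gt ((φ 0 + k * ψ 0 - r) / δ)
  rw [div_lt_iff₀ hδ] at hn
  exact ⟨0 + (n : ℝ) • u, by linarith [h 0 n n.cast_nonneg]⟩

/-- Translating the segment from `x` to `y` far along `u` brings it wholly below `r`; rays in
direction `u`, along which values only decrease, join it to `x` and `y`. -/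
theorem isPreconnected_perturbation_lt (φ : X →L[ℝ] ℝ) (hφ : φ ≠ 0) (ψ : X → ℝ)
    (hψ : LipschitzWith ‖φ‖₊ ψ) (k : ℝ) (hk : |k| < 1) (r : ℝ) :
    IsPreconnected {x | φ x + k * ψ x < r} := by
  obtain ⟨u, δ, hδ, h⟩ := exists_direction_linear_decrease φ hφ ψ hψ k hk
  have hc : Continuous fun x => φ x + k * ψ x :=
    φ.continuous.add (continuous_const.mul hψ.continuous)
  refine isPreconnected_of_forall_pair fun x hx y hy => ?_
  have hK : IsCompact (segment ℝ x y) := by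
    rw [segment_eq_image_lineMap]
    exact isCompact_Icc.image AffineMap.lineMap_continuous
  obtain ⟨B, hB⟩ := (hK.image hc).bddAbove
  obtain ⟨n, hn⟩ := exists_nat_gt ((B - r) / δ)
  rw [div_lt_iff₀ hδ] at hn
  have hray : ∀ z, φ z + k * ψ z < r →
      segment ℝ z (z + (n : ℝ) • u) ⊆ {x | φ x + k * ψ x < r} := by
    rintro z hz _ hw
    rw [segment_eq_image'] at hw
    obtain ⟨s, hs, rfl⟩ := hw
    have h1 := h z (s * n) (mul_nonneg hs.1 n.cast_nonneg)
    have h2 : 0 ≤ δ * (s * n) := mul_nonneg hδ.le (mul_nonneg hs.1 n.cast_nonneg)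
    simp only [add_sub_cancel_left, smul_smul, mem_ofPred_eq]
    linarith
  have hmid : (fun z => z + (n : ℝ) • u) '' segment ℝ x y ⊆ {x | φ x + k * ψ x < r} := by
    rintro _ ⟨z, hz, rfl⟩
    have h1 := h z n n.cast_nonneg
    have h2 := hB (mem_image_of_mem _ hz)
    simp only [mem_ofPred_eq] at *
    linarith
  have hx1 := (convex_segment (𝕜 := ℝ) x (x + (n : ℝ) • u)).isPreconnected
  have hy1 := (convex_segment (𝕜 := ℝ) y (y + (n : ℝ) • u)).isPreconnected
  have hm1 : IsPreconnected ((fun z => z + (n : ℝ) • u) '' segment ℝ x y) :=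
    (convex_segment (𝕜 := ℝ) x y).isPreconnected.image _ (by fun_prop)
  have hxm := hx1.union _ (right_mem_segment ℝ _ _)
    (mem_image_of_mem (fun z => z + (n : ℝ) • u) (left_mem_segment ℝ x y)) hm1
  have hxy := hxm.union (y + (n : ℝ) • u)
    (Or.inr (mem_image_of_mem (fun z => z + (n : ℝ) • u) (right_mem_segment ℝ x y)))
    (right_mem_segment ℝ _ _) hy1
  exact ⟨_, union_subset (union_subset (hray x hx) hmid) (hray y hy),
    Or.inl (Or.inl (left_mem_segment ℝ _ _)), Or.inr (left_mem_segment ℝ _ _), hxy⟩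

end Perturbation

/-- Between two maximizers of a convex function with different endpoint values, the function
attains its maximum everywhere. -/
theorem ConvexOn.le_of_between_maximizers {a b : ℝ} {g : ℝ → ℝ} (hg : ConvexOn ℝ (Icc a b) g)
    (hne : g a ≠ g b) {m n l : ℝ} (hm : m ∈ Icc a b) (hn : n ∈ Icc a b)
    (hgm : ∀ k ∈ Icc a b, g k ≤ g m) (hgn : ∀ k ∈ Icc a b, g k ≤ g n) (hml : m ≤ l)
    (hln : l ≤ n) : g m ≤ g l := by
  by_contra! hlt
  have hmn : g m = g n := le_antisymm (hgn m hm) (hgm n hn)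
  have hml' : m < l := hml.lt_of_ne (by rintro rfl; exact lt_irrefl _ hlt)
  have hln' : l < n := hln.lt_of_ne (by rintro rfl; linarith)
  have hl : l ∈ Icc a b := ⟨hm.1.trans hml, hln.trans hn.2⟩
  have ha : a ∈ Icc a b := left_mem_Icc.2 (hm.1.trans hm.2)
  have hb : b ∈ Icc a b := right_mem_Icc.2 (hm.1.trans hm.2)
  -- If `a < m`, the dip at `l` forces by convexity a value at `a` above the maximum.
  have ham : a = m := by
    by_contra hne'
    have := hg.lt_left_of_right_lt ha hl
      (by rw [openSegment_eq_Ioo ((hm.1.lt_of_ne hne').trans hml')]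
          exact ⟨hm.1.lt_of_ne hne', hml'⟩) hlt
    exact this.not_ge (hgm a ha)
  have hnb : n = b := by
    by_contra hne'
    have := hg.lt_right_of_left_lt hl hb
      (by rw [openSegment_eq_Ioo (hln'.trans (hn.2.lt_of_ne hne'))]
          exact ⟨hln', hn.2.lt_of_ne hne'⟩) (hmn ▸ hlt)
    exact this.not_ge (hgn b hb)
  exact hne (by rw [ham, ← hnb, hmn])

theorem dense_compl_of_interior_Icc_inter_eq_empty {a b : ℝ} (hab : a < b) {s : Set ℝ}
    (hs : interior (Icc a b ∩ s) = ∅) : Dense {l : Icc a b | (l : ℝ) ∉ s} := by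
  rw [dense_iff_inter_open]
  rintro _ ⟨O, hO, rfl⟩ ⟨l, hl⟩
  obtain ⟨k, hkO, hk⟩ := mem_closure_iff.1
    (by rw [closure_Ioo hab.ne]; exact l.2 : (l : ℝ) ∈ closure (Ioo a b)) O hO hl
  by_contra hcon
  have hsub : O ∩ Ioo a b ⊆ Icc a b ∩ s := fun z hz => ⟨Ioo_subset_Icc_self hz.2, by
    by_contra hzs
    exact hcon ⟨⟨z, Ioo_subset_Icc_self hz.2⟩, hz.1, hzs⟩⟩
  have := interior_maximal hsub (hO.inter isOpen_Ioo) ⟨hkO, hk⟩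
  rw [hs] at this
  exact this

/-- The minimax equality in the convex case. -/
theorem iSup_iInf_eq_iInf_iSup_of_convexOn {X : Type*} [NormedAddCommGroup X] [NormedSpace ℝ X]
    (φ : X →L[ℝ] ℝ) (hφ : φ ≠ 0)
    (ψ : X → ℝ) (hψ : LipschitzWith ‖φ‖₊ ψ)
    (a b : ℝ) (hab : a ≤ b)
    (γ : ℝ → ℝ) (hγ : MapsTo γ (Icc a b) (Icc (-1) 1))
    (hγc : ContinuousOn γ (Icc a b))
    (hint : interior (Icc a b ∩ γ ⁻¹' {-1, 1}) = ∅)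
    (c : ℝ) (hconv : ConvexOn ℝ (Icc a b) γ)
    (hne : ∀ x : X, 0 < ψ x → γ a * ψ x + c * a ≠ γ b * ψ x + c * b) :
    (⨆ l ∈ Icc a b ∩ γ ⁻¹' {-1, 1},
        ⨅ x : X, ((φ x + γ l * ψ x + c * l : ℝ) : EReal)) =
      ⨅ x : X, ⨆ l ∈ Icc a b, ((φ x + γ l * ψ x + c * l : ℝ) : EReal) := by
  refine le_antisymm (iSup₂_le fun l hl => le_iInf fun x => (iInf_le _ x).trans
    (le_iSup₂ (f := fun l (_ : l ∈ Icc a b) => ((φ x + γ l * ψ x + c * l : ℝ) : EReal))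
      l hl.1)) ?_
  by_contra! hlt
  obtain ⟨r, hr1, hr2⟩ := EReal.lt_iff_exists_real_btwn.1 hlt
  have habs : ∀ l ∈ Icc a b, l ∉ γ ⁻¹' {-1, 1} → |γ l| < 1 := by
    intro l hl hl'
    simp only [mem_preimage, mem_insert_iff, mem_singleton_iff, not_or] at hl'
    exact abs_lt.2 ⟨(hγ hl).1.lt_of_ne (Ne.symm hl'.1), (hγ hl).2.lt_of_ne hl'.2⟩
  have hlow : ∀ l ∈ Icc a b, ∃ x, φ x + γ l * ψ x + c * l < r := by
    intro l hl
    by_cases hl' : l ∈ γ ⁻¹' {-1, 1}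
    · have h := (le_iSup₂ (f := fun l (_ : l ∈ Icc a b ∩ γ ⁻¹' {-1, 1}) =>
        ⨅ x : X, ((φ x + γ l * ψ x + c * l : ℝ) : EReal)) l ⟨hl, hl'⟩).trans_lt hr1
      obtain ⟨x, hx⟩ := iInf_lt_iff.1 h
      exact ⟨x, EReal.coe_lt_coe_iff.1 hx⟩
    · obtain ⟨x, hx⟩ := exists_perturbation_lt φ hφ ψ hψ (γ l) (habs l hl hl') (r - c * l)
      exact ⟨x, by linarith⟩
  have hhigh : ∀ x, ∃ l ∈ Icc a b, r < φ x + γ l * ψ x + c * l := by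
    intro x
    obtain ⟨l, hl⟩ := lt_iSup_iff.1 (hr2.trans_le (iInf_le _ x))
    obtain ⟨hl', h⟩ := lt_iSup_iff.1 hl
    exact ⟨l, hl', EReal.coe_lt_coe_iff.1 h⟩
  -- The density argument needs `a < b`; on a single point, `hlow` and `hhigh` clash directly.
  rcases hab.eq_or_lt with rfl | hab'
  · obtain ⟨x, hx⟩ := hlow a (left_mem_Icc.2 le_rfl)
    obtain ⟨l, hl, h⟩ := hhigh x
    obtain rfl : l = a := le_antisymm hl.2 hl.1
    linarith
  have : Fact (a ≤ b) := ⟨hab⟩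
  have hγr : Continuous fun l : Icc a b => γ l := continuousOn_iff_continuous_domRestrict.1 hγc
  refine false_of_preconnected_sublevel
    (fun (x : X) (l : Icc a b) => φ x + γ l * ψ x + c * l) ?_ r _
    (dense_compl_of_interior_Icc_inter_eq_empty hab' hint) ?_ (fun l => hlow l l.2) ?_
  · exact ((φ.continuous.comp continuous_fst).add
      ((hγr.comp continuous_snd).mul (hψ.continuous.comp continuous_fst))).add
      (continuous_const.mul (continuous_subtype_val.comp continuous_snd))
  · intro l hl
    have := isPreconnected_perturbation_lt φ hφ ψ hψ (γ l) (habs l l.2 hl) (r - c * l)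
    simpa only [lt_sub_iff_add_lt] using this
  · intro x m n l hm hn hml hln
    obtain ⟨k, hk, hrk⟩ := hhigh x
    have hrm : r < φ x + γ m * ψ x + c * m := hrk.trans_le (hm ⟨k, hk⟩)
    have hrn : r < φ x + γ n * ψ x + c * n := hrk.trans_le (hn ⟨k, hk⟩)
    have hlin : ConvexOn ℝ (Icc a b) fun l => φ x + c * l :=
      ⟨convex_Icc a b, fun p _ q _ s t _ _ hst => by
        simp only [smul_eq_mul]
        exact le_of_eq (by linear_combination (-φ x) * hst)⟩
    have hlin' : ConcaveOn ℝ (Icc a b) fun l => φ x + c * l :=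
      ⟨convex_Icc a b, fun p _ q _ s t _ _ hst => by
        simp only [smul_eq_mul]
        exact le_of_eq (by linear_combination (φ x) * hst)⟩
    -- The sign of `ψ x` decides between convex and concave in `l`; only the convex case needs
    -- distinct endpoint values.
    rcases lt_or_ge 0 (ψ x) with hpos | hneg
    · have hg : ConvexOn ℝ (Icc a b) fun l => φ x + γ l * ψ x + c * l := by
        refine ((hconv.smul hpos.le).add hlin).congr fun l _ => ?_
        simp only [Pi.add_apply, smul_eq_mul]
        ring
      have := hg.le_of_between_maximizers
        (fun h => hne x hpos (by linarith)) m.2 n.2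
        (fun k hk => hm ⟨k, hk⟩) (fun k hk => hn ⟨k, hk⟩) hml hln
      exact hrm.le.trans this
    · have hg : ConcaveOn ℝ (Icc a b) fun l => φ x + γ l * ψ x + c * l := by
        refine ((hconv.smul (neg_nonneg.2 hneg)).neg.add hlin').congr fun l _ => ?_
        simp only [Pi.add_apply, Pi.neg_apply, smul_eq_mul]
        ring
      have hseg : (l : ℝ) ∈ segment ℝ (m : ℝ) (n : ℝ) := by
        rw [segment_eq_Icc (show (m : ℝ) ≤ n from hml.trans hln)]
        exact ⟨hml, hln⟩
      exact (le_min hrm.le hrn.le).trans (hg.ge_on_segment m.2 n.2 hseg)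

theorem theorem5 {X : Type*} [NormedAddCommGroup X] [NormedSpace ℝ X] [CompleteSpace X]
    (φ : X →L[ℝ] ℝ) (hφ : φ ≠ 0)
    (ψ : X → ℝ) (hψ : LipschitzWith ‖φ‖₊ ψ)
    (a b : ℝ) (hab : a ≤ b)
    (γ : ℝ → ℝ) (hγ : Set.MapsTo γ (Set.Icc a b) (Set.Icc (-1) 1))
    (hγc : ContinuousOn γ (Set.Icc a b))
    (hint : interior (Set.Icc a b ∩ γ ⁻¹' {-1, 1}) = ∅)
    (c : ℝ)
    (hconv :
      (ConvexOn ℝ (Set.Icc a b) γ ∧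
        ∀ x : X, 0 < ψ x → γ a * ψ x + c * a ≠ γ b * ψ x + c * b) ∨
      (ConcaveOn ℝ (Set.Icc a b) γ ∧
        ∀ x : X, ψ x < 0 → γ a * ψ x + c * a ≠ γ b * ψ x + c * b)) :
    (⨆ l ∈ Set.Icc a b ∩ γ ⁻¹' {-1, 1},
        ⨅ x : X, ((φ x + γ l * ψ x + c * l : ℝ) : EReal)) =
      ⨅ x : X, ⨆ l ∈ Set.Icc a b, ((φ x + γ l * ψ x + c * l : ℝ) : EReal) := by
  rcases hconv with ⟨hc, hne⟩ | ⟨hc, hne⟩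
  · exact iSup_iInf_eq_iInf_iSup_of_convexOn φ hφ ψ hψ a b hab γ hγ hγc hint c hc hne
  -- Replacing `(γ, ψ)` by `(-γ, -ψ)` preserves the product and turns concave into convex.
  · have hset : (-γ) ⁻¹' {-1, 1} = γ ⁻¹' {-1, 1} := by
      ext l
      simp only [mem_preimage, Pi.neg_apply, mem_insert_iff, mem_singleton_iff, neg_inj,
        neg_eq_iff_eq_neg (b := (1 : ℝ))]
      exact or_comm
    have h := iSup_iInf_eq_iInf_iSup_of_convexOn φ hφ (-ψ) hψ.neg a b hab (-γ)
      (fun l hl => ⟨neg_le_neg (hγ hl).2, neg_le.1 (hγ hl).1⟩) hγc.neg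
      (by rwa [hset]) c hc.neg
      (fun x hx => by simpa using hne x (by simpa using hx))
    simpa only [hset, Pi.neg_apply, neg_mul_neg] using h
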